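/- Let $(B,g_B)$ and $(F,g_F)$ be smooth pseudo-Riemannian manifolds (without boundary) of dimensions $m=\dim B>1$ and $n=\dim F>1$, and let $f:B\to(0,\infty)$ and $h:F\to(0,\infty)$ be smooth. Let $\pi,\sigma$ be the projections of $B\times F$ onto $B$ and $F$, and let $M=B\,{}_h\!\times_f F$ be the doubly warped product, i.e. $B\times F$ with the metric $$g_M=\langle\cdot,\cdot\rangle=(h\circ\sigma)^2\,\pi^*g_B+(f\circ\pi)^2\,\sigma^*g_F .$$ Conventions: $R_{XY}Z=D_{[X,Y]}Z-[D_X,D_Y]Z$ for the Levi-Civita connection $D$; $\mathrm{Ric}(X,Y)=\sum_i\epsilon_i\langle R_{XE_i}Y,E_i\rangle$ for an orthonormal frame $E_i$, $\epsilon_i=\langle E_i,E_i\rangle$; $H^u(X,Y)=XYu-(D_XY)u$; $\Delta u=\sum_i\epsilon_i\langle D_{E_i}\,\mathrm{grad}\,u,E_i\rangle$. Let $(p,q)\in M$, let $X,Y$ be (lifts to $M$ of) vectors tangent to $B$ at $p$, and $V,W$ (lifts to $M$ of) vectors tangent to $F$ at $q$. Then at $(p,q)$: 1. ${}^M\mathrm{Ric}(X,Y)={}^B\mathrm{Ric}(X,Y)-\langle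 X,Y\rangle\left[\dfrac{{}^F\Delta h}{h}+(m-1)\dfrac{\|\mathrm{grad}\,h\|^2}{h^2}\right]-\dfrac nf\,H^f(X,Y)$; 2. ${}^M\mathrm{Ric}(X,V)=(m+n-2)\left(\dfrac{Xf}{f}\right)\left(\dfrac{Vh}{h}\right)$; 3. ${}^M\mathrm{Ric}(V,W)={}^F\mathrm{Ric}(V,W)-\langle V,W\rangle\left[\dfrac{{}^B\Delta f}{f}+(n-1)\dfrac{\|\mathrm{grad}\,f\|^2}{f^2}\right]-\dfrac mh\,H^h(V,W)$. Here ${}^B\mathrm{Ric}$, $H^f$ are taken on $(B,g_B)$ and ${}^F\mathrm{Ric}$, $H^h$ on $(F,g_F)$; $\|\mathrm{grad}\,h\|^2$ and $\|\mathrm{grad}\,f\|^2$ are the squares, in $g_M$, of the $g_M$-gradients of $h\circ\sigma$ and $f\circ\pi$; ${}^F\Delta h$ is the Laplacian of $h$ at $q$ for the metric $f(p)^2g_F$ which $g_M$ induces on the fibre $\{p\}\times F$, and ${}^B\Delta f$ is the Laplacian of $f$ at $p$ for the metric $h(q)^2g_B$ which $g_M$ induces on the leaf $B\times\{q\}$.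 (So, in terms of the Laplacians of $g_F$ and $g_B$, ${}^F\Delta h=f^{-2}\Delta_{g_F}h$ and ${}^B\Delta f=h^{-2}\Delta_{g_B}f$.) -/

import Mathlib

open scoped Manifold ContDiff

noncomputable section

namespace DoublyWarped

/-! ### Pseudo-Riemannian geometry on (an open part of) a vector space

`G y` is a bilinear form on `E` depending on the point `y : E`: a metric written in a chart with
values in `E`. Vector fields are maps `E → E`. -/

section Local

variable {E : Type*} [NormedAddCommGroup E] [NormedSpace ℝ E] [FiniteDimensional ℝ E]

/-- The Christoffel map `Γ(v, w)` at `y`: the covariant derivative `D_v w` of the constant fields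
`v`, `w`, determined by the Koszul formula
`2⟨Γ(v, w), z⟩ = v⟨w, z⟩ + w⟨v, z⟩ - z⟨v, w⟩` for constant fields `z`
(`(G y).inverse` raises the index). -/
def christoffel (G : E → E →L[ℝ] E →L[ℝ] ℝ) (y v w : E) : E :=
  (G y).inverse ((1 / 2 : ℝ) •
    (fderiv ℝ G y v w + fderiv ℝ G y w v - ((fderiv ℝ G y).flip v).flip w))

/-- The Levi-Civita covariant derivative `D_X Y` of vector fields. -/
def covDeriv (G : E → E →L[ℝ] E →L[ℝ] ℝ) (X Y : E → E) : E → E :=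
  fun y => fderiv ℝ Y y (X y) + christoffel G y (X y) (Y y)

/-- The Riemann curvature `R_{XY}Z = D_{[X,Y]}Z - [D_X, D_Y]Z`. -/
def riemann (G : E → E →L[ℝ] E →L[ℝ] ℝ) (X Y Z : E → E) : E → E :=
  covDeriv G (VectorField.lieBracket ℝ X Y) Z
    - (covDeriv G X (covDeriv G Y Z) - covDeriv G Y (covDeriv G X Z))

/-- The trace of a linear operator `A` of `E`, in a basis of `E`. If `e` is an orthonormal basis of
a nondegenerate symmetric bilinear form, then this is `∑ i, ε i * ⟨A (e i), e i⟩`. -/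
def traceOp (A : E → E) : ℝ :=
  ∑ i, (Module.finBasis ℝ E).coord i (A (Module.finBasis ℝ E i))

/-- The Ricci tensor `Ric(v, w) = ∑ i, ε i * ⟨R_{v e_i} w, e_i⟩` at `y`, i.e. the trace of
`z ↦ R_{v z} w`; curvature is tensorial, so the vectors are extended to constant fields. -/
def ricciLocal (G : E → E →L[ℝ] E →L[ℝ] ℝ) (y v w : E) : ℝ :=
  traceOp fun z => riemann G (fun _ => v) (fun _ => z) (fun _ => w) y

/-- The gradient field of a function. -/
def gradLocal (G : E → E →L[ℝ] E →L[ℝ] ℝ) (u : E → ℝ) : E → E :=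
  fun y => (G y).inverse (fderiv ℝ u y)

/-- The Hessian `H^u(X, Y) = X(Yu) - (D_X Y)u` at `y`, on the constant fields `v`, `w`. -/
def hessianLocal (G : E → E →L[ℝ] E →L[ℝ] ℝ) (u : E → ℝ) (y v w : E) : ℝ :=
  fderiv ℝ (fun z => fderiv ℝ u z w) y v
    - fderiv ℝ u y (covDeriv G (fun _ => v) (fun _ => w) y)

/-- The Laplacian `∑ i, ε i * ⟨D_{e_i} (grad u), e_i⟩` at `y`, i.e. the trace of
`v ↦ D_v (grad u)`. -/
def laplacianLocal (G : E → E →L[ℝ] E →L[ℝ] ℝ) (u : E → ℝ) (y : E) : ℝ :=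
  traceOp fun v => covDeriv G (fun _ => v) (gradLocal G u) y

end Local

/-! ### Pseudo-Riemannian manifolds -/

/-- The pullback `(v, w) ↦ b (A v) (A w)` of a bilinear form `b` by a linear map `A`. -/
def pullbackForm {V W : Type*} [AddCommGroup V] [Module ℝ V] [TopologicalSpace V]
    [IsTopologicalAddGroup V] [ContinuousSMul ℝ V]
    [AddCommGroup W] [Module ℝ W] [TopologicalSpace W] [IsTopologicalAddGroup W]
    [ContinuousSMul ℝ W]
    (b : W →L[ℝ] W →L[ℝ] ℝ) (A : V →L[ℝ] W) : V →L[ℝ] V →L[ℝ] ℝ :=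
  (ContinuousLinearMap.precomp ℝ A).comp (b.comp A)

section Manifold

variable {E : Type*} [NormedAddCommGroup E] [NormedSpace ℝ E] [FiniteDimensional ℝ E]
  {H : Type*} [TopologicalSpace H] (I : ModelWithCorners ℝ E H)
  {M : Type*} [TopologicalSpace M] [ChartedSpace H M]

/-- A field of bilinear forms written in the chart at `x₀`, i.e. pulled back by the inverse of
that chart. -/
def formInChart (g : ∀ x : M, TangentSpace I x →L[ℝ] TangentSpace I x →L[ℝ] ℝ) (x₀ : M) :
    E → E →L[ℝ] E →L[ℝ] ℝ := fun y =>
  pullbackForm (V := E) (g ((extChartAt I x₀).symm y))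
    (mfderiv 𝓘(ℝ, E) I (extChartAt I x₀).symm y)

variable (M) in
/-- A pseudo-Riemannian metric: a smooth field of symmetric nondegenerate bilinear forms on the
tangent spaces, smoothness meaning that the components in charts are smooth.
(Its index is locally constant, which is automatic.) -/
structure PseudoRiemannianMetric where
  val : ∀ x : M, TangentSpace I x →L[ℝ] TangentSpace I x →L[ℝ] ℝ
  symm : ∀ x v w, val x v w = val x w v
  nondegenerate : ∀ x v, (∀ w, val x v w = 0) → v = 0
  smooth : ∀ x₀ : M, ContDiffOn ℝ ∞ (formInChart I val x₀) (extChartAt I x₀).target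

/-- The derivative `v u` of a function `u` in the direction of a tangent vector `v`. -/
def dirDeriv (u : M → ℝ) (x : M) (v : TangentSpace I x) : ℝ := mfderiv I 𝓘(ℝ, ℝ) u x v

/-- The components of a tangent vector at `x` in the chart at `x`. -/
def vecInChart (x : M) (v : TangentSpace I x) : E := mfderiv I 𝓘(ℝ, E) (extChartAt I x) x v

namespace PseudoRiemannianMetric

variable {I}
variable (g : PseudoRiemannianMetric I M)

/-- The Ricci tensor at `x`, computed in the chart at `x`. -/
def ricci (x : M) (v w : TangentSpace I x) : ℝ :=
  ricciLocal (formInChart I g.val x) (extChartAt I x x) (vecInChart I x v) (vecInChart I x w)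

/-- The Hessian `H^u` at `x`, computed in the chart at `x`. -/
def hessian (u : M → ℝ) (x : M) (v w : TangentSpace I x) : ℝ :=
  hessianLocal (formInChart I g.val x) (u ∘ (extChartAt I x).symm) (extChartAt I x x)
    (vecInChart I x v) (vecInChart I x w)

/-- The Laplacian `Δ u` at `x`, computed in the chart at `x`. -/
def laplacian (u : M → ℝ) (x : M) : ℝ :=
  laplacianLocal (formInChart I g.val x) (u ∘ (extChartAt I x).symm) (extChartAt I x x)

/-- The gradient of a function: the tangent vector with `⟨grad u, v⟩ = v u` for all `v`. -/
def grad (u : M → ℝ) (x : M) : TangentSpace I x :=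
  (g.val x).inverse (mfderiv I 𝓘(ℝ, ℝ) u x)

/-- `‖grad u‖² = ⟨grad u, grad u⟩` (of any sign). -/
def gradNormSq (u : M → ℝ) (x : M) : ℝ := g.val x (g.grad u x) (g.grad u x)

/-- The metric `c • g` for a nonzero constant `c`. -/
def scale (c : ℝ) (hc : c ≠ 0) : PseudoRiemannianMetric I M where
  val x := c • g.val x
  symm x v w := by
    change c * g.val x v w = c * g.val x w v
    rw [g.symm]
  nondegenerate x v hv := by
    refine g.nondegenerate x v fun w => ?_
    have h : c * g.val x v w = 0 := hv w
    exact (mul_eq_zero.1 h).resolve_left hc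
  smooth x₀ := by
    have h : formInChart I (fun x => c • g.val x) x₀ = fun y => c • formInChart I g.val x₀ y := by
      funext y; rfl
    rw [h]
    exact (g.smooth x₀).const_smul c

end PseudoRiemannianMetric

end Manifold

/-! ### Doubly warped products -/

section Product

variable {E : Type*} [NormedAddCommGroup E] [NormedSpace ℝ E]
  {H : Type*} [TopologicalSpace H] {I : ModelWithCorners ℝ E H}
  {B : Type*} [TopologicalSpace B] [ChartedSpace H B]
  {E' : Type*} [NormedAddCommGroup E'] [NormedSpace ℝ E']
  {H' : Type*} [TopologicalSpace H'] {J : ModelWithCorners ℝ E' H'}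
  {F : Type*} [TopologicalSpace F] [ChartedSpace H' F]

variable (I J) in
/-- The lift of a vector `x ∈ T_p B` to `T_(p,q) (B × F)`: the image of `x` under the derivative of
the inclusion of the leaf `B × {q}`. -/
def liftB (p : B) (q : F) (x : TangentSpace I p) : TangentSpace (I.prod J) (p, q) :=
  mfderiv I (I.prod J) (fun p' : B => (p', q)) p x

variable (I J) in
/-- The lift of a vector `v ∈ T_q F` to `T_(p,q) (B × F)`: the image of `v` under the derivative of
the inclusion of the fibre `{p} × F`. -/
def liftF (p : B) (q : F) (v : TangentSpace J q) : TangentSpace (I.prod J) (p, q) :=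
  mfderiv J (I.prod J) (fun q' : F => (p, q')) q v

/-- The forms `(h ∘ σ)² π^* g_B + (f ∘ π)² σ^* g_F` on `B × F`. -/
def warpedForm (gB : PseudoRiemannianMetric I B) (gF : PseudoRiemannianMetric J F)
    (h : F → ℝ) (f : B → ℝ) (z : B × F) :
    TangentSpace (I.prod J) z →L[ℝ] TangentSpace (I.prod J) z →L[ℝ] ℝ :=
  (h z.2) ^ 2 • pullbackForm (gB.val z.1) (mfderiv (I.prod J) I Prod.fst z)
    + (f z.1) ^ 2 • pullbackForm (gF.val z.2) (mfderiv (I.prod J) J Prod.snd z)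

theorem warpedForm_apply (gB : PseudoRiemannianMetric I B) (gF : PseudoRiemannianMetric J F)
    (h : F → ℝ) (f : B → ℝ) (z : B × F) (v w : TangentSpace (I.prod J) z) :
    warpedForm gB gF h f z v w
      = (h z.2) ^ 2 * gB.val z.1 (mfderiv (I.prod J) I Prod.fst z v)
          (mfderiv (I.prod J) I Prod.fst z w)
        + (f z.1) ^ 2 * gF.val z.2 (mfderiv (I.prod J) J Prod.snd z v)
          (mfderiv (I.prod J) J Prod.snd z w) := rfl

theorem mfderiv_fst_liftB (p : B) (q : F) (x : TangentSpace I p) :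
    mfderiv (I.prod J) I Prod.fst (p, q) (liftB I J p q x) = x := by
  unfold liftB
  rw [mfderiv_fst, mfderiv_prod_left]
  rfl

theorem mfderiv_snd_liftB (p : B) (q : F) (x : TangentSpace I p) :
    mfderiv (I.prod J) J Prod.snd (p, q) (liftB I J p q x) = 0 := by
  unfold liftB
  rw [mfderiv_snd, mfderiv_prod_left]
  rfl

theorem mfderiv_fst_liftF (p : B) (q : F) (v : TangentSpace J q) :
    mfderiv (I.prod J) I Prod.fst (p, q) (liftF I J p q v) = 0 := by
  unfold liftF
  rw [mfderiv_fst, mfderiv_prod_right]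
  rfl

theorem mfderiv_snd_liftF (p : B) (q : F) (v : TangentSpace J q) :
    mfderiv (I.prod J) J Prod.snd (p, q) (liftF I J p q v) = v := by
  unfold liftF
  rw [mfderiv_snd, mfderiv_prod_right]
  rfl

theorem formInChart_warpedForm [IsManifold I ∞ B] [IsManifold J ∞ F]
    [I.Boundaryless] [J.Boundaryless]
    (gB : PseudoRiemannianMetric I B) (gF : PseudoRiemannianMetric J F)
    (h : F → ℝ) (f : B → ℝ) (z₀ : B × F) (y : E × E')
    (hy : y ∈ (extChartAt (I.prod J) z₀).target) (v w : E × E') :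
    formInChart (I.prod J) (warpedForm gB gF h f) z₀ y v w
      = (h ((extChartAt J z₀.2).symm y.2)) ^ 2 * formInChart I gB.val z₀.1 y.1 v.1 w.1
        + (f ((extChartAt I z₀.1).symm y.1)) ^ 2 * formInChart J gF.val z₀.2 y.2 v.2 w.2 := by
  have : IsManifold I 1 B := IsManifold.of_le (n := ∞) (by simp)
  have : IsManifold J 1 F := IsManifold.of_le (n := ∞) (by simp)
  rw [extChartAt_prod] at hy
  have h1 : MDifferentiableAt 𝓘(ℝ, E) I (extChartAt I z₀.1).symm y.1 :=
    (mdifferentiableOn_extChartAt_symm (I := I) (x := z₀.1)).mdifferentiableAt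
      ((isOpen_extChartAt_target z₀.1).mem_nhds hy.1)
  have h2 : MDifferentiableAt 𝓘(ℝ, E') J (extChartAt J z₀.2).symm y.2 :=
    (mdifferentiableOn_extChartAt_symm (I := J) (x := z₀.2)).mdifferentiableAt
      ((isOpen_extChartAt_target z₀.2).mem_nhds hy.2)
  have key : mfderiv 𝓘(ℝ, E × E') (I.prod J) (extChartAt (I.prod J) z₀).symm y
      = (mfderiv 𝓘(ℝ, E) I (extChartAt I z₀.1).symm y.1).prodMap
          (mfderiv 𝓘(ℝ, E') J (extChartAt J z₀.2).symm y.2) := by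
    rw [modelWithCornersSelf_prod, ← chartedSpaceSelf_prod, extChartAt_prod]
    exact mfderiv_prodMap h1 h2
  have hfst : ∀ v : E × E', mfderiv (I.prod J) I Prod.fst ((extChartAt (I.prod J) z₀).symm y)
      (mfderiv 𝓘(ℝ, E × E') (I.prod J) (extChartAt (I.prod J) z₀).symm y v)
      = mfderiv 𝓘(ℝ, E) I (extChartAt I z₀.1).symm y.1 v.1 := by
    intro v
    rw [mfderiv_fst, key]
    rfl
  have hsnd : ∀ v : E × E', mfderiv (I.prod J) J Prod.snd ((extChartAt (I.prod J) z₀).symm y)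
      (mfderiv 𝓘(ℝ, E × E') (I.prod J) (extChartAt (I.prod J) z₀).symm y v)
      = mfderiv 𝓘(ℝ, E') J (extChartAt J z₀.2).symm y.2 v.2 := by
    intro v
    rw [mfderiv_snd, key]
    rfl
  refine (warpedForm_apply gB gF h f ((extChartAt (I.prod J) z₀).symm y) _ _).trans ?_
  exact congrArg₂ (· + ·)
    (congrArg₂ (fun a b => h ((extChartAt J z₀.2).symm y.2) ^ 2 *
      gB.val ((extChartAt I z₀.1).symm y.1) a b) (hfst v) (hfst w))
    (congrArg₂ (fun a b => f ((extChartAt I z₀.1).symm y.1) ^ 2 *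
      gF.val ((extChartAt J z₀.2).symm y.2) a b) (hsnd v) (hsnd w))

/-- The metric of the doubly warped product: `B × F` with the metric
`(h ∘ σ)² π^* g_B + (f ∘ π)² σ^* g_F`, where `π : B × F → B` and `σ : B × F → F` are the
projections. -/
def doublyWarped [FiniteDimensional ℝ E] [FiniteDimensional ℝ E']
    [IsManifold I ∞ B] [IsManifold J ∞ F] [I.Boundaryless] [J.Boundaryless]
    (gB : PseudoRiemannianMetric I B) (gF : PseudoRiemannianMetric J F)
    (h : F → ℝ) (hh : ContMDiff J 𝓘(ℝ, ℝ) ∞ h) (hpos : ∀ q, 0 < h q)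
    (f : B → ℝ) (hf : ContMDiff I 𝓘(ℝ, ℝ) ∞ f) (fpos : ∀ p, 0 < f p) :
    PseudoRiemannianMetric (I.prod J) (B × F) where
  val := warpedForm gB gF h f
  symm z v w := by
    rw [warpedForm_apply, warpedForm_apply, gB.symm, gF.symm]
  nondegenerate := by
    rintro ⟨p, q⟩ v hv
    have h1 : mfderiv (I.prod J) I Prod.fst (p, q) v = 0 := by
      refine gB.nondegenerate p _ fun x => ?_
      have h0 := hv (liftB I J p q x)
      rw [warpedForm_apply, mfderiv_fst_liftB, mfderiv_snd_liftB, map_zero, mul_zero, add_zero]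
        at h0
      exact (mul_eq_zero.1 h0).resolve_left (pow_pos (hpos q) 2).ne'
    have h2 : mfderiv (I.prod J) J Prod.snd (p, q) v = 0 := by
      refine gF.nondegenerate q _ fun x => ?_
      have h0 := hv (liftF I J p q x)
      rw [warpedForm_apply, mfderiv_fst_liftF, mfderiv_snd_liftF, map_zero, mul_zero, zero_add]
        at h0
      exact (mul_eq_zero.1 h0).resolve_left (pow_pos (fpos p) 2).ne'
    rw [mfderiv_fst] at h1
    rw [mfderiv_snd] at h2
    exact Prod.ext h1 h2
  smooth z₀ := by
    refine contDiffOn_clm_apply.2 fun v => contDiffOn_clm_apply.2 fun w => ?_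
    refine ContDiffOn.congr ?_ fun y hy => formInChart_warpedForm gB gF h f z₀ y hy v w
    have h1 : Set.MapsTo Prod.fst (extChartAt (I.prod J) z₀).target (extChartAt I z₀.1).target := by
      rw [extChartAt_prod]
      exact fun y hy => hy.1
    have h2 : Set.MapsTo Prod.snd (extChartAt (I.prod J) z₀).target (extChartAt J z₀.2).target := by
      rw [extChartAt_prod]
      exact fun y hy => hy.2
    have cf : ContDiffOn ℝ ∞ (f ∘ (extChartAt I z₀.1).symm) (extChartAt I z₀.1).target :=
      contMDiffOn_iff_contDiffOn.1 (hf.comp_contMDiffOn (contMDiffOn_extChartAt_symm z₀.1))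
    have ch : ContDiffOn ℝ ∞ (h ∘ (extChartAt J z₀.2).symm) (extChartAt J z₀.2).target :=
      contMDiffOn_iff_contDiffOn.1 (hh.comp_contMDiffOn (contMDiffOn_extChartAt_symm z₀.2))
    have cB := (gB.smooth z₀.1).comp contDiffOn_fst h1
    have cF := (gF.smooth z₀.2).comp contDiffOn_snd h2
    exact (((ch.comp contDiffOn_snd h2).pow 2).mul
        ((cB.clm_apply contDiffOn_const).clm_apply contDiffOn_const)).add
      (((cf.comp contDiffOn_fst h1).pow 2).mul
        ((cF.clm_apply contDiffOn_const).clm_apply contDiffOn_const))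

end Product

end DoublyWarped

end

/-!
Everything is a computation in charts. The product chart at `(p, q)` turns the metric of `M` into
`h² GB + f² GF` on an open set `U ×ˢ V` of `E × E'` (`warpedOn_formInChart`), where `GB` and `GF`
are the metrics of `B` and `F` in charts. Writing tangent vectors as pairs, the Koszul formula gives
the Christoffel map of this metric (`WarpedOn.christoffel_eq`): its `B`-component on `v`, `w` is
`Γ_B(v₁, w₁) + (v₂h / h) w₁ + (w₂h / h) v₁ - (GF(v₂, w₂) / h²) f grad f`,
and its `F`-component is obtained by exchanging the roles of the factors.

The Ricci tensor is the trace of `z ↦ R_{vz} w`, that is, the sum of the traces of its two diagonal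
blocks (`traceOp_prod`), so four components of the curvature are enough.
* For `v`, `w` tangent to `B`, the block of `B` (`WarpedOn.riemann_base_base_base_fst`) is the
  curvature of `B` plus `|grad h|²`-multiples of the identity and of a rank-one operator, which
  contribute the factor `m - 1`; the block of `F` (`WarpedOn.riemann_base_fiber_base_snd`) is
  `-H^f(v, w) / f` times the identity, whence `-n H^f / f`, minus a multiple of `z ↦ D_z grad h`,
  whence the Laplacian.
* For `v` tangent to `B` and `w` to `F`, each block (`WarpedOn.riemann_base_base_fiber_fst`,
  `WarpedOn.riemann_base_fiber_fiber_snd`) is `(vf / f) (wh / h)` times the identity, plus a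
  rank-one operator of trace `-(vf / f) (wh / h)`, whence `m + n - 2`.
* The case of `v`, `w` tangent to `F` follows from the first one by exchanging the factors
  (`WarpedOn.swap`), since the Ricci tensor is invariant under linear isometries
  (`MetricOn.ricciLocal_pullback`).
-/

open scoped Manifold ContDiff

noncomputable section

namespace DoublyWarped

/-! ### Traces -/

section Trace

variable {E : Type*} [NormedAddCommGroup E] [NormedSpace ℝ E] [FiniteDimensional ℝ E]
  {E' : Type*} [NormedAddCommGroup E'] [NormedSpace ℝ E'] [FiniteDimensional ℝ E']

/-- `traceOp` is the trace of a linear map, hence does not depend on the basis in its definition. -/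
theorem traceOp_coe (A : E →ₗ[ℝ] E) : traceOp A = LinearMap.trace ℝ E A := by
  rw [LinearMap.trace_eq_matrix_trace ℝ (Module.finBasis ℝ E)]
  simp [traceOp, Matrix.trace, LinearMap.toMatrix_apply]

theorem traceOp_add (A A' : E → E) :
    traceOp (fun z => A z + A' z) = traceOp A + traceOp A' := by
  simp [traceOp, Finset.sum_add_distrib]

theorem traceOp_smul (c : ℝ) (A : E → E) : traceOp (fun z => c • A z) = c * traceOp A := by
  simp [traceOp, Finset.mul_sum]

theorem traceOp_id : traceOp (fun z : E => z) = Module.finrank ℝ E := by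
  simp [traceOp]

theorem traceOp_rankOne (φ : E →L[ℝ] ℝ) (u : E) : traceOp (fun z => φ z • u) = φ u := by
  conv_rhs => rw [← (Module.finBasis ℝ E).sum_repr u]
  rw [map_sum]
  simp [traceOp, mul_comm]

/-- The trace is the sum of the traces of the diagonal blocks. -/
theorem traceOp_prod (A : E × E' → E × E') (hadd : ∀ z z', A (z + z') = A z + A z')
    (hsmul : ∀ (c : ℝ) z, A (c • z) = c • A z) :
    traceOp A = traceOp (fun z : E => (A (z, 0)).1) + traceOp (fun z : E' => (A (0, z)).2) := by
  let L : E × E' →ₗ[ℝ] E × E' := ⟨⟨A, hadd⟩, hsmul⟩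
  have h : traceOp A = LinearMap.trace ℝ _ L := traceOp_coe L
  rw [h, LinearMap.trace_eq_matrix_trace ℝ
    ((Module.finBasis ℝ E).prod (Module.finBasis ℝ E'))]
  simp [traceOp, Matrix.trace, LinearMap.toMatrix_apply, L]

/-- The trace is invariant under conjugation by a linear isomorphism. -/
theorem traceOp_conj (e : E ≃L[ℝ] E') (A : E → E) (hadd : ∀ z z', A (z + z') = A z + A z')
    (hsmul : ∀ (c : ℝ) z, A (c • z) = c • A z) :
    traceOp (fun z => e (A (e.symm z))) = traceOp A := by
  let L : E →ₗ[ℝ] E := ⟨⟨A, hadd⟩, hsmul⟩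
  exact (traceOp_coe (e.toLinearEquiv.conj L)).trans
    ((LinearMap.trace_conj' L e.toLinearEquiv).trans (traceOp_coe L).symm)

end Trace

/-! ### Metrics on open sets of a vector space -/

section Metric

variable {E : Type*} [NormedAddCommGroup E] [NormedSpace ℝ E]
  {E' : Type*} [NormedAddCommGroup E'] [NormedSpace ℝ E'] [FiniteDimensional ℝ E']

/-- `G` is a pseudo-Riemannian metric on the open set `U` of a vector space. -/
structure MetricOn (G : E → E →L[ℝ] E →L[ℝ] ℝ) (U : Set E) : Prop where
  isOpen : IsOpen U
  smooth : ContDiffOn ℝ ∞ G U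
  symm : ∀ y ∈ U, ∀ v w, G y v w = G y w v
  nondegenerate : ∀ y ∈ U, ∀ v, (∀ w, G y v w = 0) → v = 0

variable {G : E → E →L[ℝ] E →L[ℝ] ℝ} {U : Set E} {y : E}

theorem christoffel_add_left (v v' w : E) :
    christoffel G y (v + v') w = christoffel G y v w + christoffel G y v' w := by
  simp only [christoffel, ← map_add, ← smul_add]
  congr 2
  ext z
  simp
  ring

theorem christoffel_smul_left (c : ℝ) (v w : E) :
    christoffel G y (c • v) w = c • christoffel G y v w := by
  simp only [christoffel, ← map_smul]
  congr 1
  ext z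
  simp
  ring

theorem christoffel_add_right (v w w' : E) :
    christoffel G y v (w + w') = christoffel G y v w + christoffel G y v w' := by
  simp only [christoffel, ← map_add, ← smul_add]
  congr 2
  ext z
  simp
  ring

theorem christoffel_smul_right (c : ℝ) (v w : E) :
    christoffel G y v (c • w) = c • christoffel G y v w := by
  simp only [christoffel, ← map_smul]
  congr 1
  ext z
  simp
  ring

theorem christoffel_zero_left (w : E) : christoffel G y 0 w = 0 := by
  simpa using christoffel_smul_left (G := G) (y := y) 0 0 w

theorem christoffel_zero_right (v : E) : christoffel G y v 0 = 0 := by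
  simpa using christoffel_smul_right (G := G) (y := y) 0 v 0

/-- For constant fields, `R_{vz} w = D_z (D_v w) - D_v (D_z w)`. -/
theorem riemann_const (v z w : E) :
    riemann G (fun _ => v) (fun _ => z) (fun _ => w) y
      = fderiv ℝ (fun x => christoffel G x v w) y z + christoffel G y z (christoffel G y v w)
        - (fderiv ℝ (fun x => christoffel G x z w) y v
          + christoffel G y v (christoffel G y z w)) := by
  have hc : ∀ a b : E, covDeriv G (fun _ => a) (fun _ => b) = fun x => christoffel G x a b := by
    intro a b
    funext x
    simp [covDeriv]
  have hl : VectorField.lieBracket ℝ (fun _ : E => v) (fun _ => z) = fun _ => 0 := by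
    funext x
    simp [VectorField.lieBracket]
  simp only [riemann, hl, hc, Pi.sub_apply]
  simp only [covDeriv, christoffel_zero_left]
  abel

theorem fderiv_apply_apply (h : DifferentiableAt ℝ G y) (s v w : E) :
    fderiv ℝ G y s v w = fderiv ℝ (fun x => G x v w) y s := by
  have h1 := (h.hasFDerivAt.clm_apply (hasFDerivAt_const v y)).clm_apply (hasFDerivAt_const w y)
  rw [h1.fderiv]
  simp

namespace MetricOn

variable (hG : MetricOn G U)
include hG

theorem differentiableAt (hy : y ∈ U) : DifferentiableAt ℝ G y :=
  (hG.smooth.contDiffAt (hG.isOpen.mem_nhds hy)).differentiableAt (by simp)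

/-- Pulling a metric back by a linear isomorphism. -/
theorem pullback (e : E' ≃L[ℝ] E) :
    MetricOn (fun x => pullbackForm (G (e x)) (e : E' →L[ℝ] E)) (e ⁻¹' U) where
  isOpen := hG.isOpen.preimage e.continuous
  smooth := by
    refine contDiffOn_clm_apply.2 fun v => contDiffOn_clm_apply.2 fun w => ?_
    have h : ContDiffOn ℝ ∞ (fun x => G (e x)) (e ⁻¹' U) :=
      hG.smooth.comp e.contDiff.contDiffOn fun x hx => hx
    exact (h.clm_apply contDiffOn_const).clm_apply contDiffOn_const
  symm x hx v w := hG.symm _ hx _ _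
  nondegenerate x hx v hv := by
    refine e.map_eq_zero_iff.1 (hG.nondegenerate _ hx _ fun w => ?_)
    have h := hv (e.symm w)
    change G (e x) (e v) (e (e.symm w)) = 0 at h
    rwa [e.apply_symm_apply] at h

end MetricOn

variable [FiniteDimensional ℝ E]

/-- In finite dimension, a nondegenerate form identifies the space with its dual, so the
`inverse` raising indices in the definitions is not the junk value `0`. -/
theorem isInvertible_of_nondegenerate {b : E →L[ℝ] E →L[ℝ] ℝ}
    (hb : ∀ v, (∀ w, b v w = 0) → v = 0) : b.IsInvertible := by
  have inj : Function.Injective (b : E →ₗ[ℝ] E →L[ℝ] ℝ) := by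
    refine (injective_iff_map_eq_zero _).2 fun v hv => hb v fun w => ?_
    exact congrArg (fun l : E →L[ℝ] ℝ => l w) hv
  have dim : Module.finrank ℝ E = Module.finrank ℝ (E →L[ℝ] ℝ) := by
    rw [← (LinearMap.toContinuousLinearMap (𝕜 := ℝ) (E := E) (F' := ℝ)).finrank_eq]
    exact (Subspace.dual_finrank_eq).symm
  refine ⟨(LinearEquiv.ofInjectiveOfFinrankEq (b : E →ₗ[ℝ] E →L[ℝ] ℝ) inj
    dim).toContinuousLinearEquiv, ?_⟩
  ext v w
  rfl

namespace MetricOn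

variable (hG : MetricOn G U)
include hG

theorem isInvertible (hy : y ∈ U) : (G y).IsInvertible :=
  isInvertible_of_nondegenerate (hG.nondegenerate y hy)

theorem contDiffOn_inverse : ContDiffOn ℝ ∞ (fun y => (G y).inverse) U := fun y hy =>
  ((hG.isInvertible hy).contDiffAt_map_inverse.comp y
    (hG.smooth.contDiffAt (hG.isOpen.mem_nhds hy))).contDiffWithinAt

theorem apply_inverse (hy : y ∈ U) (φ : E →L[ℝ] ℝ) (z : E) : G y ((G y).inverse φ) z = φ z := by
  rw [(hG.isInvertible hy).self_apply_inverse]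

theorem ext (hy : y ∈ U) {u u' : E} (h : ∀ z, G y u z = G y u' z) : u = u' :=
  (hG.isInvertible hy).injective (ContinuousLinearMap.ext h)

theorem apply_gradLocal (hy : y ∈ U) (u : E → ℝ) (z : E) :
    G y (gradLocal G u y) z = fderiv ℝ u y z :=
  hG.apply_inverse hy _ z

/-- The Koszul formula for constant fields. -/
theorem koszul (hy : y ∈ U) (v w z : E) :
    2 * G y (christoffel G y v w) z
      = fderiv ℝ (fun x => G x w z) y v + fderiv ℝ (fun x => G x v z) y w
        - fderiv ℝ (fun x => G x v w) y z := by
  simp only [← fderiv_apply_apply (hG.differentiableAt hy)]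
  rw [christoffel, hG.apply_inverse hy]
  simp

/-- The Koszul formula determines the Christoffel map. -/
theorem christoffel_eq (hy : y ∈ U) (v w u : E)
    (h : ∀ z, 2 * G y u z
      = fderiv ℝ (fun x => G x w z) y v + fderiv ℝ (fun x => G x v z) y w
        - fderiv ℝ (fun x => G x v w) y z) :
    christoffel G y v w = u := by
  refine hG.ext hy fun z => ?_
  have h1 := hG.koszul hy v w z
  rw [← h z] at h1
  linarith

/-- The Levi-Civita connection is torsion-free. -/
theorem christoffel_comm (hy : y ∈ U) (v w : E) :
    christoffel G y v w = christoffel G y w v := by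
  refine hG.christoffel_eq hy _ _ _ fun z => ?_
  rw [hG.koszul hy]
  have h : (fun x => G x v w) =ᶠ[nhds y] fun x => G x w v := by
    filter_upwards [hG.isOpen.mem_nhds hy] with x hx using hG.symm x hx v w
  rw [h.fderiv_eq]
  ring

theorem contDiffOn_christoffel (v w : E) :
    ContDiffOn ℝ ∞ (fun y => christoffel G y v w) U := by
  have h := hG.smooth.fderiv_of_isOpen (m := ∞) hG.isOpen (by simp)
  refine hG.contDiffOn_inverse.clm_apply ?_
  refine ((((h.clm_apply contDiffOn_const).clm_apply contDiffOn_const).add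
    ((h.clm_apply contDiffOn_const).clm_apply contDiffOn_const)).sub ?_).const_smul (1 / 2 : ℝ)
  refine contDiffOn_clm_apply.2 fun z => ?_
  exact ((h.clm_apply contDiffOn_const).clm_apply contDiffOn_const).clm_apply contDiffOn_const

theorem differentiableAt_christoffel (hy : y ∈ U) (v w : E) :
    DifferentiableAt ℝ (fun y => christoffel G y v w) y :=
  ((hG.contDiffOn_christoffel v w).contDiffAt (hG.isOpen.mem_nhds hy)).differentiableAt (by simp)

theorem contDiffOn_gradLocal {u : E → ℝ} (hu : ContDiffOn ℝ ∞ u U) :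
    ContDiffOn ℝ ∞ (gradLocal G u) U :=
  hG.contDiffOn_inverse.clm_apply (hu.fderiv_of_isOpen hG.isOpen (by simp))

/-- `z ↦ R_{vz} w` is additive; with `riemann_const_smul` this makes it an operator with a trace. -/
theorem riemann_const_add (hy : y ∈ U) (v w z z' : E) :
    riemann G (fun _ => v) (fun _ => z + z') (fun _ => w) y
      = riemann G (fun _ => v) (fun _ => z) (fun _ => w) y
        + riemann G (fun _ => v) (fun _ => z') (fun _ => w) y := by
  simp only [riemann_const, christoffel_add_left, christoffel_add_right, map_add]
  rw [fderiv_fun_add (hG.differentiableAt_christoffel hy _ _)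
    (hG.differentiableAt_christoffel hy _ _)]
  simp only [add_apply]
  abel

theorem riemann_const_smul (hy : y ∈ U) (c : ℝ) (v w z : E) :
    riemann G (fun _ => v) (fun _ => c • z) (fun _ => w) y
      = c • riemann G (fun _ => v) (fun _ => z) (fun _ => w) y := by
  simp only [riemann_const, christoffel_smul_left, christoffel_smul_right, map_smul]
  rw [fderiv_fun_const_smul (hG.differentiableAt_christoffel hy _ _)]
  simp only [smul_apply, smul_add, smul_sub]

/-- Naturality of the connection under linear isometries. -/
theorem christoffel_pullback (e : E' ≃L[ℝ] E) {x : E'} (hx : e x ∈ U) (v w : E') :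
    christoffel (fun x => pullbackForm (G (e x)) (e : E' →L[ℝ] E)) x v w
      = e.symm (christoffel G (e x) (e v) (e w)) := by
  refine (hG.pullback e).christoffel_eq hx _ _ _ fun z => ?_
  have hd : ∀ a b s : E', fderiv ℝ (fun x => pullbackForm (G (e x)) (e : E' →L[ℝ] E) a b) x s
      = fderiv ℝ (fun y => G y (e a) (e b)) (e x) (e s) := by
    intro a b s
    have h := e.comp_right_fderiv (f := fun y => G y (e a) (e b)) (x := x)
    exact congrArg (fun l : E' →L[ℝ] ℝ => l s) h
  simp only [hd]
  rw [← hG.koszul hx]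
  change 2 * G (e x) (e (e.symm _)) (e z) = _
  rw [e.apply_symm_apply]

/-- Naturality of the curvature under linear isometries. -/
theorem riemann_pullback (e : E' ≃L[ℝ] E) {x : E'} (hx : e x ∈ U) (v z w : E') :
    riemann (fun x => pullbackForm (G (e x)) (e : E' →L[ℝ] E)) (fun _ => v) (fun _ => z)
      (fun _ => w) x
      = e.symm (riemann G (fun _ => e v) (fun _ => e z) (fun _ => e w) (e x)) := by
  have hd : ∀ a b s : E',
      fderiv ℝ (fun x => christoffel (fun x => pullbackForm (G (e x)) (e : E' →L[ℝ] E)) x a b) x s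
        = e.symm (fderiv ℝ (fun y => christoffel G y (e a) (e b)) (e x) (e s)) := by
    intro a b s
    have h : (fun x => christoffel (fun x => pullbackForm (G (e x)) (e : E' →L[ℝ] E)) x a b)
        =ᶠ[nhds x] (e.symm ∘ (fun y => christoffel G y (e a) (e b)) ∘ e) := by
      filter_upwards [(hG.pullback e).isOpen.mem_nhds hx] with x' hx'
      exact hG.christoffel_pullback e hx' a b
    rw [h.fderiv_eq, e.symm.comp_fderiv, e.comp_right_fderiv]
    rfl
  simp only [riemann_const, hd, hG.christoffel_pullback e hx, e.apply_symm_apply, map_add, map_sub]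

/-- The Ricci tensor is invariant under linear isometries. -/
theorem ricciLocal_pullback (e : E' ≃L[ℝ] E) {x : E'} (hx : e x ∈ U) (v w : E') :
    ricciLocal (fun x => pullbackForm (G (e x)) (e : E' →L[ℝ] E)) x v w
      = ricciLocal G (e x) (e v) (e w) := by
  rw [ricciLocal, ricciLocal, ← traceOp_conj e.symm _ (hG.riemann_const_add hx _ _)
    fun c z => hG.riemann_const_smul hx c _ _ z]
  simp only [hG.riemann_pullback e hx]
  rfl

end MetricOn

/-- Scaling a metric by a constant keeps its connection and divides gradients by the constant,
hence divides the Laplacian by it. -/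
theorem laplacianLocal_smul {c : ℝ} (hc : c ≠ 0) (hG : MetricOn G U) {u : E → ℝ}
    (hu : ContDiffOn ℝ ∞ u U) (hy : y ∈ U) :
    laplacianLocal (fun y => c • G y) u y = c⁻¹ * laplacianLocal G u y := by
  have hcG : MetricOn (fun y => c • G y) U :=
    { isOpen := hG.isOpen
      smooth := hG.smooth.const_smul c
      symm := fun y hy v w => congrArg (c * ·) (hG.symm y hy v w)
      nondegenerate := fun y hy v hv => hG.nondegenerate y hy v fun w =>
        (mul_eq_zero.1 (hv w)).resolve_left hc }
  have hΓ : ∀ v w, christoffel (fun y => c • G y) y v w = christoffel G y v w := by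
    intro v w
    refine hcG.christoffel_eq hy _ _ _ fun z => ?_
    have hd : ∀ a b s : E, fderiv ℝ (fun y => (c • G y) a b) y s
        = c * fderiv ℝ (fun y => G y a b) y s := by
      intro a b s
      have h0 := ((hG.differentiableAt hy).clm_apply
        (differentiableAt_const a)).clm_apply (differentiableAt_const b)
      have h := fderiv_const_mul h0 c
      exact congrArg (fun l : E →L[ℝ] ℝ => l s) h
    simp only [hd]
    rw [← mul_add, ← mul_sub, ← hG.koszul hy]
    simp
    ring
  have hgrad : ∀ x ∈ U, gradLocal (fun y => c • G y) u x = c⁻¹ • gradLocal G u x := by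
    intro x hx
    refine hcG.ext hx fun z => ?_
    rw [hcG.apply_gradLocal hx, ← hG.apply_gradLocal hx]
    simp [hc]
  have hgrad' : gradLocal (fun y => c • G y) u =ᶠ[nhds y] fun x => c⁻¹ • gradLocal G u x := by
    filter_upwards [hG.isOpen.mem_nhds hy] with x hx using hgrad x hx
  have hdiff : DifferentiableAt ℝ (gradLocal G u) y :=
    ((hG.contDiffOn_gradLocal hu).contDiffAt (hG.isOpen.mem_nhds hy)).differentiableAt (by simp)
  rw [laplacianLocal, laplacianLocal, ← traceOp_smul]
  congr 1
  funext v
  simp only [covDeriv, hΓ, hgrad'.fderiv_eq, hgrad y hy, christoffel_smul_right]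
  rw [fderiv_fun_const_smul hdiff]
  simp

end Metric

/-! ### The Levi-Civita connection of a doubly warped metric -/

section Warped

variable {E : Type*} [NormedAddCommGroup E] [NormedSpace ℝ E]
  {E' : Type*} [NormedAddCommGroup E'] [NormedSpace ℝ E']

/-- `G` is the doubly warped metric `h² GB + f² GF` on the product of the open sets `U` and `V`.
Outside `U ×ˢ V` the forms may be arbitrary. -/
structure WarpedOn (GB : E → E →L[ℝ] E →L[ℝ] ℝ) (GF : E' → E' →L[ℝ] E' →L[ℝ] ℝ)
    (G : E × E' → E × E' →L[ℝ] E × E' →L[ℝ] ℝ) (f : E → ℝ) (h : E' → ℝ)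
    (U : Set E) (V : Set E') : Prop where
  base : MetricOn GB U
  fiber : MetricOn GF V
  total : MetricOn G (U ×ˢ V)
  smooth_f : ContDiffOn ℝ ∞ f U
  smooth_h : ContDiffOn ℝ ∞ h V
  f_ne : ∀ x ∈ U, f x ≠ 0
  h_ne : ∀ y ∈ V, h y ≠ 0
  apply : ∀ x ∈ U, ∀ y ∈ V, ∀ v w : E × E',
    G (x, y) v w = h y ^ 2 * GB x v.1 w.1 + f x ^ 2 * GF y v.2 w.2

theorem fderiv_comp_fst {X : Type*} [NormedAddCommGroup X] [NormedSpace ℝ X] {k : E → X} {x : E}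
    (hk : DifferentiableAt ℝ k x) (y : E') (s : E × E') :
    fderiv ℝ (fun p : E × E' => k p.1) (x, y) s = fderiv ℝ k x s.1 := by
  have h : HasFDerivAt (fun p : E × E' => k p.1) _ (x, y) :=
    hk.hasFDerivAt.comp (x, y) hasFDerivAt_fst
  rw [h.fderiv]
  rfl

theorem fderiv_comp_snd {X : Type*} [NormedAddCommGroup X] [NormedSpace ℝ X] {k : E' → X} {y : E'}
    (hk : DifferentiableAt ℝ k y) (x : E) (s : E × E') :
    fderiv ℝ (fun p : E × E' => k p.2) (x, y) s = fderiv ℝ k y s.2 := by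
  have h : HasFDerivAt (fun p : E × E' => k p.2) _ (x, y) :=
    hk.hasFDerivAt.comp (x, y) hasFDerivAt_snd
  rw [h.fderiv]
  rfl

theorem fderiv_fst_smul_snd {X : Type*} [NormedAddCommGroup X] [NormedSpace ℝ X]
    {k : E → ℝ} {l : E' → X} {x : E} {y : E'}
    (hk : DifferentiableAt ℝ k x) (hl : DifferentiableAt ℝ l y) (s : E × E') :
    fderiv ℝ (fun p : E × E' => k p.1 • l p.2) (x, y) s
      = k x • fderiv ℝ l y s.2 + fderiv ℝ k x s.1 • l y := by
  have h1 : HasFDerivAt (fun p : E × E' => k p.1) _ (x, y) :=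
    hk.hasFDerivAt.comp (x, y) hasFDerivAt_fst
  have h2 : HasFDerivAt (fun p : E × E' => l p.2) _ (x, y) :=
    hl.hasFDerivAt.comp (x, y) hasFDerivAt_snd
  rw [(h1.fun_smul h2).fderiv]
  simp

theorem fderiv_fst_of_eventuallyEq {X Y : Type*} [NormedAddCommGroup X] [NormedSpace ℝ X]
    [NormedAddCommGroup Y] [NormedSpace ℝ Y] {k : E → X × Y} {l : E → X} {x : E}
    (hk : DifferentiableAt ℝ k x) (h : ∀ᶠ y in nhds x, (k y).1 = l y) (s : E) :
    (fderiv ℝ k x s).1 = fderiv ℝ l x s := by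
  rw [← Filter.EventuallyEq.fderiv_eq h, fderiv.fst hk]
  rfl

theorem fderiv_snd_of_eventuallyEq {X Y : Type*} [NormedAddCommGroup X] [NormedSpace ℝ X]
    [NormedAddCommGroup Y] [NormedSpace ℝ Y] {k : E → X × Y} {l : E → Y} {x : E}
    (hk : DifferentiableAt ℝ k x) (h : ∀ᶠ y in nhds x, (k y).2 = l y) (s : E) :
    (fderiv ℝ k x s).2 = fderiv ℝ l x s := by
  rw [← Filter.EventuallyEq.fderiv_eq h, fderiv.snd hk]
  rfl

namespace WarpedOn

variable {GB : E → E →L[ℝ] E →L[ℝ] ℝ} {GF : E' → E' →L[ℝ] E' →L[ℝ] ℝ}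
  {G : E × E' → E × E' →L[ℝ] E × E' →L[ℝ] ℝ} {f : E → ℝ} {h : E' → ℝ}
  {U : Set E} {V : Set E'} (W : WarpedOn GB GF G f h U V) {x : E} {y : E'}
include W

theorem prod_mem_nhds (hx : x ∈ U) (hy : y ∈ V) : U ×ˢ V ∈ nhds (x, y) :=
  W.total.isOpen.mem_nhds ⟨hx, hy⟩

theorem differentiableAt_f (hx : x ∈ U) : DifferentiableAt ℝ f x :=
  (W.smooth_f.contDiffAt (W.base.isOpen.mem_nhds hx)).differentiableAt (by simp)

theorem differentiableAt_h (hy : y ∈ V) : DifferentiableAt ℝ h y :=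
  (W.smooth_h.contDiffAt (W.fiber.isOpen.mem_nhds hy)).differentiableAt (by simp)

/-- The derivative of the components of the warped metric, which enter the Koszul formula. -/
theorem fderiv_apply (hx : x ∈ U) (hy : y ∈ V) (v w s : E × E') :
    fderiv ℝ (fun p => G p v w) (x, y) s
      = h y ^ 2 * fderiv ℝ (fun x => GB x v.1 w.1) x s.1
        + 2 * h y * fderiv ℝ h y s.2 * GB x v.1 w.1
        + (f x ^ 2 * fderiv ℝ (fun y => GF y v.2 w.2) y s.2
        + 2 * f x * fderiv ℝ f x s.1 * GF y v.2 w.2) := by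
  have heq : (fun p => G p v w) =ᶠ[nhds (x, y)]
      fun p => h p.2 ^ 2 * GB p.1 v.1 w.1 + f p.1 ^ 2 * GF p.2 v.2 w.2 := by
    filter_upwards [W.prod_mem_nhds hx hy] with p hp using W.apply p.1 hp.1 p.2 hp.2 v w
  have h1 : DifferentiableAt ℝ (fun x => GB x v.1 w.1) x :=
    ((W.base.differentiableAt hx).clm_apply (differentiableAt_const _)).clm_apply
      (differentiableAt_const _)
  have h2 : DifferentiableAt ℝ (fun y => GF y v.2 w.2) y :=
    ((W.fiber.differentiableAt hy).clm_apply (differentiableAt_const _)).clm_apply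
      (differentiableAt_const _)
  have k1 : HasFDerivAt (fun p : E × E' => GB p.1 v.1 w.1) _ (x, y) :=
    HasFDerivAt.comp (g := fun x => GB x v.1 w.1) (x, y) h1.hasFDerivAt hasFDerivAt_fst
  have k2 : HasFDerivAt (fun p : E × E' => GF p.2 v.2 w.2) _ (x, y) :=
    HasFDerivAt.comp (g := fun y => GF y v.2 w.2) (x, y) h2.hasFDerivAt hasFDerivAt_snd
  have k3 : HasFDerivAt (fun p : E × E' => f p.1) _ (x, y) :=
    (W.differentiableAt_f hx).hasFDerivAt.comp (x, y) hasFDerivAt_fst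
  have k4 : HasFDerivAt (fun p : E × E' => h p.2) _ (x, y) :=
    (W.differentiableAt_h hy).hasFDerivAt.comp (x, y) hasFDerivAt_snd
  rw [heq.fderiv_eq, (((k4.pow 2).fun_mul k1).fun_add ((k3.pow 2).fun_mul k2)).fderiv]
  simp
  ring

theorem differentiableAt_dlog_f (hx : x ∈ U) (v : E) :
    DifferentiableAt ℝ (fun x => fderiv ℝ f x v / f x) x := by
  have h1 : ContDiffOn ℝ ∞ (fderiv ℝ f) U :=
    W.smooth_f.fderiv_of_isOpen W.base.isOpen (by simp)
  have h2 := (h1.contDiffAt (W.base.isOpen.mem_nhds hx)).differentiableAt (by simp)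
  simp only [div_eq_mul_inv]
  exact (h2.clm_apply (differentiableAt_const v)).fun_mul
    ((W.differentiableAt_f hx).fun_inv (W.f_ne x hx))

theorem differentiableAt_dlog_h (hy : y ∈ V) (v : E') :
    DifferentiableAt ℝ (fun y => fderiv ℝ h y v / h y) y := by
  have h1 : ContDiffOn ℝ ∞ (fderiv ℝ h) V :=
    W.smooth_h.fderiv_of_isOpen W.fiber.isOpen (by simp)
  have h2 := (h1.contDiffAt (W.fiber.isOpen.mem_nhds hy)).differentiableAt (by simp)
  simp only [div_eq_mul_inv]
  exact (h2.clm_apply (differentiableAt_const v)).fun_mul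
    ((W.differentiableAt_h hy).fun_inv (W.h_ne y hy))

theorem differentiableAt_base_div (hx : x ∈ U) (v w : E) :
    DifferentiableAt ℝ (fun x => -(GB x v w / f x ^ 2)) x := by
  simp only [div_eq_mul_inv]
  exact ((((W.base.differentiableAt hx).clm_apply (differentiableAt_const _)).clm_apply
    (differentiableAt_const _)).fun_mul (((W.differentiableAt_f hx).fun_pow 2).fun_inv
    (pow_ne_zero 2 (W.f_ne x hx)))).fun_neg

variable [FiniteDimensional ℝ E']

theorem differentiableAt_gradLocal_h (hy : y ∈ V) : DifferentiableAt ℝ (gradLocal GF h) y :=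
  ((W.fiber.contDiffOn_gradLocal W.smooth_h).contDiffAt
    (W.fiber.isOpen.mem_nhds hy)).differentiableAt (by simp)

variable [FiniteDimensional ℝ E]

/-- The Levi-Civita connection of the doubly warped metric. -/
theorem christoffel_eq (hx : x ∈ U) (hy : y ∈ V) (v w : E × E') :
    christoffel G (x, y) v w
      = (christoffel GB x v.1 w.1 + (fderiv ℝ h y v.2 / h y) • w.1 + (fderiv ℝ h y w.2 / h y) • v.1
          - (GF y v.2 w.2 / h y ^ 2) • f x • gradLocal GB f x,
        christoffel GF y v.2 w.2 + (fderiv ℝ f x v.1 / f x) • w.2 + (fderiv ℝ f x w.1 / f x) • v.2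
          - (GB x v.1 w.1 / f x ^ 2) • h y • gradLocal GF h y) := by
  refine W.total.christoffel_eq ⟨hx, hy⟩ _ _ _ fun z => ?_
  have h0 := W.h_ne y hy
  have f0 := W.f_ne x hx
  have kB := W.base.koszul hx v.1 w.1 z.1
  have kF := W.fiber.koszul hy v.2 w.2 z.2
  simp only [W.fderiv_apply hx hy, W.apply x hx y hy, map_add, map_sub, map_smul,
    add_apply, sub_apply, smul_apply, smul_eq_mul, W.base.apply_gradLocal hx,
    W.fiber.apply_gradLocal hy]
  field_simp
  linear_combination h y ^ 2 * kB + f x ^ 2 * kF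

theorem christoffel_base_base (hx : x ∈ U) (hy : y ∈ V) (v w : E) :
    christoffel G (x, y) (v, 0) (w, 0)
      = (christoffel GB x v w, (-(GB x v w / f x ^ 2)) • h y • gradLocal GF h y) := by
  rw [W.christoffel_eq hx hy]
  simp [christoffel_zero_left]

theorem christoffel_fiber_fiber (hx : x ∈ U) (hy : y ∈ V) (v w : E') :
    christoffel G (x, y) (0, v) (0, w)
      = ((-(GF y v w / h y ^ 2)) • f x • gradLocal GB f x, christoffel GF y v w) := by
  rw [W.christoffel_eq hx hy]
  simp [christoffel_zero_left]

theorem christoffel_base_fiber (hx : x ∈ U) (hy : y ∈ V) (v : E) (w : E') :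
    christoffel G (x, y) (v, 0) (0, w)
      = ((fderiv ℝ h y w / h y) • v, (fderiv ℝ f x v / f x) • w) := by
  rw [W.christoffel_eq hx hy]
  simp [christoffel_zero_left, christoffel_zero_right]

theorem christoffel_fiber_base (hx : x ∈ U) (hy : y ∈ V) (v : E') (w : E) :
    christoffel G (x, y) (0, v) (w, 0)
      = ((fderiv ℝ h y v / h y) • w, (fderiv ℝ f x w / f x) • v) := by
  rw [W.christoffel_eq hx hy]
  simp [christoffel_zero_left, christoffel_zero_right]

/-- To differentiate a component of the Christoffel map, it suffices to know that component on
`U ×ˢ V`. -/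
theorem fderiv_christoffel_fst (hx : x ∈ U) (hy : y ∈ V) (v w s : E × E') {l : E × E' → E}
    (hl : ∀ x ∈ U, ∀ y ∈ V, (christoffel G (x, y) v w).1 = l (x, y)) :
    (fderiv ℝ (fun p => christoffel G p v w) (x, y) s).1 = fderiv ℝ l (x, y) s :=
  fderiv_fst_of_eventuallyEq (W.total.differentiableAt_christoffel ⟨hx, hy⟩ v w) (by
    filter_upwards [W.prod_mem_nhds hx hy] with p hp using hl p.1 hp.1 p.2 hp.2) s

theorem fderiv_christoffel_snd (hx : x ∈ U) (hy : y ∈ V) (v w s : E × E') {l : E × E' → E'}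
    (hl : ∀ x ∈ U, ∀ y ∈ V, (christoffel G (x, y) v w).2 = l (x, y)) :
    (fderiv ℝ (fun p => christoffel G p v w) (x, y) s).2 = fderiv ℝ l (x, y) s :=
  fderiv_snd_of_eventuallyEq (W.total.differentiableAt_christoffel ⟨hx, hy⟩ v w) (by
    filter_upwards [W.prod_mem_nhds hx hy] with p hp using hl p.1 hp.1 p.2 hp.2) s

/-- The gradient of `h` for the warped metric is tangent to the fibres, and is `f⁻²` times its
gradient for `GF`. -/
theorem gradLocal_comp_snd (hx : x ∈ U) (hy : y ∈ V) :
    gradLocal G (fun p => h p.2) (x, y) = (0, (f x ^ 2)⁻¹ • gradLocal GF h y) := by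
  have f0 := W.f_ne x hx
  refine W.total.ext (y := (x, y)) ⟨hx, hy⟩ fun z => ?_
  rw [W.total.apply_gradLocal ⟨hx, hy⟩, W.apply x hx y hy,
    fderiv_comp_snd (W.differentiableAt_h hy)]
  simp [W.fiber.apply_gradLocal hy, f0]

/-- The gradient of `f` for the warped metric is tangent to the leaves, and is `h⁻²` times its
gradient for `GB`. -/
theorem gradLocal_comp_fst (hx : x ∈ U) (hy : y ∈ V) :
    gradLocal G (fun p => f p.1) (x, y) = ((h y ^ 2)⁻¹ • gradLocal GB f x, 0) := by
  have h0 := W.h_ne y hy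
  refine W.total.ext (y := (x, y)) ⟨hx, hy⟩ fun z => ?_
  rw [W.total.apply_gradLocal ⟨hx, hy⟩, W.apply x hx y hy,
    fderiv_comp_fst (W.differentiableAt_f hx)]
  simp [W.base.apply_gradLocal hx, h0]

/-- The squared norm of the gradient of `h` for the warped metric. -/
theorem fderiv_gradLocal_comp_snd (hx : x ∈ U) (hy : y ∈ V) :
    fderiv ℝ (fun p : E × E' => h p.2) (x, y) (gradLocal G (fun p => h p.2) (x, y))
      = (f x ^ 2)⁻¹ * fderiv ℝ h y (gradLocal GF h y) := by
  rw [W.gradLocal_comp_snd hx hy, fderiv_comp_snd (W.differentiableAt_h hy)]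
  simp

/-- The squared norm of the gradient of `f` for the warped metric. -/
theorem fderiv_gradLocal_comp_fst (hx : x ∈ U) (hy : y ∈ V) :
    fderiv ℝ (fun p : E × E' => f p.1) (x, y) (gradLocal G (fun p => f p.1) (x, y))
      = (h y ^ 2)⁻¹ * fderiv ℝ f x (gradLocal GB f x) := by
  rw [W.gradLocal_comp_fst hx hy, fderiv_comp_fst (W.differentiableAt_f hx)]
  simp

/-! ### The curvature of a doubly warped metric -/

/-- The `B`-component of `R_{vz} w` for `v`, `z`, `w` tangent to `B`. The second term is rank one
in `z`, the third a multiple of the identity. -/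
theorem riemann_base_base_base_fst (hx : x ∈ U) (hy : y ∈ V) (v z w : E) :
    (riemann G (fun _ => (v, 0)) (fun _ => (z, 0)) (fun _ => (w, 0)) (x, y)).1
      = riemann GB (fun _ => v) (fun _ => z) (fun _ => w) x
        + ((fderiv ℝ h y (gradLocal GF h y) / f x ^ 2) * GB x w z) • v
        + (-(fderiv ℝ h y (gradLocal GF h y) / f x ^ 2 * GB x v w)) • z := by
  have h0 := W.h_ne y hy
  have hd : ∀ a b s : E,
      (fderiv ℝ (fun p => christoffel G p (a, 0) (b, 0)) (x, y) (s, 0)).1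
        = fderiv ℝ (fun x => christoffel GB x a b) x s := by
    intro a b s
    rw [W.fderiv_christoffel_fst hx hy _ _ _ (l := fun p => christoffel GB p.1 a b)
        fun x hx y hy => by rw [W.christoffel_base_base hx hy],
      fderiv_comp_fst (W.base.differentiableAt_christoffel hx _ _)]
  simp only [riemann_const, Prod.fst_add, Prod.fst_sub, hd, W.christoffel_base_base hx hy,
    W.christoffel_eq hx hy (v, 0) (_, _), W.christoffel_eq hx hy (z, 0) (_, _), map_zero, map_smul,
    zero_div, zero_smul, zero_apply, W.base.symm x hx w z, smul_eq_mul]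
  -- The warping factor `h` of the field `h grad h` cancels against `dh / h`.
  rw [show -(GB x z w / f x ^ 2) * (h y * fderiv ℝ h y (gradLocal GF h y)) / h y
      = -(fderiv ℝ h y (gradLocal GF h y) / f x ^ 2 * GB x z w) by field_simp,
    show -(GB x v w / f x ^ 2) * (h y * fderiv ℝ h y (gradLocal GF h y)) / h y
      = -(fderiv ℝ h y (gradLocal GF h y) / f x ^ 2 * GB x v w) by field_simp]
  module

/-- The `F`-component of `R_{vz} w` for `v`, `w` tangent to `B` and `z` tangent to `F`. -/
theorem riemann_base_fiber_base_snd (hx : x ∈ U) (hy : y ∈ V) (v w : E) (z : E') :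
    (riemann G (fun _ => (v, 0)) (fun _ => (0, z)) (fun _ => (w, 0)) (x, y)).2
      = (-(hessianLocal GB f x v w / f x)) • z
        + (-(GB x v w / f x ^ 2 * h y)) • covDeriv GF (fun _ => z) (gradLocal GF h) y := by
  have h0 := W.h_ne y hy
  have f0 := W.f_ne x hx
  have hd1 : (fderiv ℝ (fun p => christoffel G p (v, 0) (w, 0)) (x, y) (0, z)).2
      = (-(GB x v w / f x ^ 2)) • (h y • fderiv ℝ (gradLocal GF h) y z
          + fderiv ℝ h y z • gradLocal GF h y) := by
    have hQ := (W.differentiableAt_h hy).fun_smul (W.differentiableAt_gradLocal_h hy)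
    rw [W.fderiv_christoffel_snd hx hy _ _ _
        (l := fun p => (-(GB p.1 v w / f p.1 ^ 2)) • (h p.2 • gradLocal GF h p.2))
        fun x hx y hy => by rw [W.christoffel_base_base hx hy],
      fderiv_fst_smul_snd (W.differentiableAt_base_div hx v w) hQ,
      fderiv_fun_smul (W.differentiableAt_h hy) (W.differentiableAt_gradLocal_h hy)]
    simp
  have hd2 : (fderiv ℝ (fun p => christoffel G p (0, z) (w, 0)) (x, y) (v, 0)).2
      = (fderiv ℝ (fun x => fderiv ℝ f x w) x v / f x
          - fderiv ℝ f x w * fderiv ℝ f x v / f x ^ 2) • z := by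
    have h1 : ContDiffOn ℝ ∞ (fderiv ℝ f) U :=
      W.smooth_f.fderiv_of_isOpen W.base.isOpen (by simp)
    have h2 := (((h1.contDiffAt (W.base.isOpen.mem_nhds hx)).differentiableAt (by simp))
      ).clm_apply (differentiableAt_const w)
    rw [W.fderiv_christoffel_snd hx hy _ _ _
        (l := fun p => (fderiv ℝ f p.1 w / f p.1) • z)
        fun x hx y hy => by rw [W.christoffel_fiber_base hx hy],
      fderiv_fst_smul_snd (l := fun _ => z) (W.differentiableAt_dlog_f hx w)
        (differentiableAt_const z)]
    have h3 : HasFDerivAt (fun x => fderiv ℝ f x w * (f x)⁻¹) _ x := h2.hasFDerivAt.fun_mul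
      ((hasDerivAt_inv f0).comp_hasFDerivAt x (W.differentiableAt_f hx).hasFDerivAt)
    simp only [div_eq_mul_inv]
    rw [h3.fderiv]
    simp
    congr 1
    field_simp
    ring
  simp only [riemann_const, Prod.snd_add, Prod.snd_sub, hd1, hd2, W.christoffel_base_base hx hy,
    W.christoffel_fiber_base hx hy]
  simp only [W.christoffel_eq hx hy, map_zero, christoffel_zero_left, map_smul,
    zero_div, zero_smul, zero_apply, smul_eq_mul, hessianLocal, covDeriv, fderiv_fun_const,
    Pi.zero_apply, zero_add, christoffel_smul_right]
  match_scalars <;> field_simp <;> ring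

/-- The `B`-component of `R_{vz} w` for `v`, `z` tangent to `B` and `w` tangent to `F`. -/
theorem riemann_base_base_fiber_fst (hx : x ∈ U) (hy : y ∈ V) (v z : E) (w : E') :
    (riemann G (fun _ => (v, 0)) (fun _ => (z, 0)) (fun _ => (0, w)) (x, y)).1
      = (fderiv ℝ h y w / h y * (fderiv ℝ f x v / f x)) • z
        + (fderiv ℝ f x z) • (-(fderiv ℝ h y w / h y / f x)) • v := by
  have hd : ∀ a s : E, (fderiv ℝ (fun p => christoffel G p (a, 0) (0, w)) (x, y) (s, 0)).1 = 0 := by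
    intro a s
    have h1 := (W.differentiableAt_dlog_h hy w).fun_smul (differentiableAt_const a)
    rw [W.fderiv_christoffel_fst hx hy _ _ _ (l := fun p => (fderiv ℝ h p.2 w / h p.2) • a)
        fun x hx y hy => by rw [W.christoffel_base_fiber hx hy]]
    rw [fderiv_comp_snd (k := fun y => (fderiv ℝ h y w / h y) • a) h1]
    simp
  simp only [riemann_const, Prod.fst_add, Prod.fst_sub, hd, W.christoffel_base_fiber hx hy]
  simp only [W.christoffel_eq hx hy, map_zero, christoffel_zero_left, map_smul,
    zero_div, zero_smul, zero_apply, smul_eq_mul, zero_add, christoffel_smul_right,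
    W.base.christoffel_comm hx z v]
  match_scalars <;> field_simp <;> ring

/-- The `F`-component of `R_{vz} w` for `v` tangent to `B` and `z`, `w` tangent to `F`. -/
theorem riemann_base_fiber_fiber_snd (hx : x ∈ U) (hy : y ∈ V) (v : E) (z w : E') :
    (riemann G (fun _ => (v, 0)) (fun _ => (0, z)) (fun _ => (0, w)) (x, y)).2
      = (fderiv ℝ h y w / h y * (fderiv ℝ f x v / f x)) • z
        + GF y w z • (-(fderiv ℝ f x v / f x / h y)) • gradLocal GF h y := by
  have h0 := W.h_ne y hy
  have f0 := W.f_ne x hx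
  have hd1 : (fderiv ℝ (fun p => christoffel G p (v, 0) (0, w)) (x, y) (0, z)).2 = 0 := by
    have h1 := (W.differentiableAt_dlog_f hx v).fun_smul (differentiableAt_const w)
    rw [W.fderiv_christoffel_snd hx hy _ _ _ (l := fun p => (fderiv ℝ f p.1 v / f p.1) • w)
        fun x hx y hy => by rw [W.christoffel_base_fiber hx hy]]
    rw [fderiv_comp_fst (k := fun x => (fderiv ℝ f x v / f x) • w) h1]
    simp
  have hd2 : (fderiv ℝ (fun p => christoffel G p (0, z) (0, w)) (x, y) (v, 0)).2 = 0 := by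
    rw [W.fderiv_christoffel_snd hx hy _ _ _ (l := fun p => christoffel GF p.2 z w)
        fun x hx y hy => by rw [W.christoffel_fiber_fiber hx hy],
      fderiv_comp_snd (W.fiber.differentiableAt_christoffel hy z w)]
    simp
  simp only [riemann_const, Prod.snd_add, Prod.snd_sub, hd1, hd2, W.christoffel_base_fiber hx hy,
    W.christoffel_fiber_fiber hx hy]
  simp only [W.christoffel_eq hx hy, map_zero, christoffel_zero_left, map_smul,
    zero_div, zero_smul, zero_apply, smul_eq_mul, zero_add, christoffel_smul_right,
    W.base.symm x hx v (gradLocal GB f x), W.base.apply_gradLocal hx, W.fiber.symm y hy w z]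
  match_scalars <;> field_simp <;> ring

/-! ### The Ricci tensor of a doubly warped metric -/

/-- The Ricci tensor as the sum of the traces of the two diagonal blocks. -/
theorem ricciLocal_eq (hx : x ∈ U) (hy : y ∈ V) (v w : E × E') :
    ricciLocal G (x, y) v w
      = traceOp (fun z : E => (riemann G (fun _ => v) (fun _ => (z, 0)) (fun _ => w) (x, y)).1)
        + traceOp (fun z : E' =>
          (riemann G (fun _ => v) (fun _ => (0, z)) (fun _ => w) (x, y)).2) :=
  traceOp_prod _ (W.total.riemann_const_add ⟨hx, hy⟩ v w)
    fun c z => W.total.riemann_const_smul ⟨hx, hy⟩ c v w z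

theorem ricciLocal_base_base (hx : x ∈ U) (hy : y ∈ V) (v w : E) :
    ricciLocal G (x, y) (v, 0) (w, 0)
      = ricciLocal GB x v w
        - h y ^ 2 * GB x v w *
          ((f x ^ 2)⁻¹ * laplacianLocal GF h y / h y
            + ((Module.finrank ℝ E : ℝ) - 1) *
              ((f x ^ 2)⁻¹ * fderiv ℝ h y (gradLocal GF h y) / h y ^ 2))
        - (Module.finrank ℝ E' : ℝ) / f x * hessianLocal GB f x v w := by
  have h0 := W.h_ne y hy
  have f0 := W.f_ne x hx
  rw [W.ricciLocal_eq hx hy]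
  simp only [W.riemann_base_base_base_fst hx hy, W.riemann_base_fiber_base_snd hx hy]
  rw [traceOp_add, traceOp_add, traceOp_smul, traceOp_id, traceOp_add, traceOp_smul, traceOp_id,
    traceOp_smul]
  simp only [mul_smul]
  rw [traceOp_smul, traceOp_rankOne]
  change ricciLocal GB x v w + _ + _ + (_ + _ * laplacianLocal GF h y) = _
  rw [W.base.symm x hx w v]
  field_simp
  ring

theorem ricciLocal_base_fiber (hx : x ∈ U) (hy : y ∈ V) (v : E) (w : E') :
    ricciLocal G (x, y) (v, 0) (0, w)
      = ((Module.finrank ℝ E : ℝ) + (Module.finrank ℝ E' : ℝ) - 2)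
        * (fderiv ℝ f x v / f x) * (fderiv ℝ h y w / h y) := by
  have h0 := W.h_ne y hy
  have f0 := W.f_ne x hx
  rw [W.ricciLocal_eq hx hy]
  simp only [W.riemann_base_base_fiber_fst hx hy, W.riemann_base_fiber_fiber_snd hx hy]
  rw [traceOp_add, traceOp_smul, traceOp_id, traceOp_rankOne, traceOp_add, traceOp_smul, traceOp_id,
    traceOp_rankOne]
  simp only [map_smul, smul_apply, smul_eq_mul, W.fiber.symm y hy w, W.fiber.apply_gradLocal hy]
  field_simp
  ring

/-- Exchanging the two factors of a doubly warped metric. -/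
theorem swap :
    WarpedOn GF GB
      (fun p => pullbackForm (G (ContinuousLinearEquiv.prodComm ℝ E' E p))
        (ContinuousLinearEquiv.prodComm ℝ E' E : E' × E →L[ℝ] E × E')) h f V U where
  base := W.fiber
  fiber := W.base
  total := by
    convert W.total.pullback (ContinuousLinearEquiv.prodComm ℝ E' E) using 1
    ext p
    simp [and_comm]
  smooth_f := W.smooth_h
  smooth_h := W.smooth_f
  f_ne := W.h_ne
  h_ne := W.f_ne
  apply y hy x hx v w := (W.apply x hx y hy v.swap w.swap).trans (add_comm _ _)

theorem ricciLocal_fiber_fiber (hx : x ∈ U) (hy : y ∈ V) (v w : E') :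
    ricciLocal G (x, y) (0, v) (0, w)
      = ricciLocal GF y v w
        - f x ^ 2 * GF y v w *
          ((h y ^ 2)⁻¹ * laplacianLocal GB f x / f x
            + ((Module.finrank ℝ E' : ℝ) - 1) *
              ((h y ^ 2)⁻¹ * fderiv ℝ f x (gradLocal GB f x) / f x ^ 2))
        - (Module.finrank ℝ E : ℝ) / h y * hessianLocal GF h y v w :=
  (W.total.ricciLocal_pullback (ContinuousLinearEquiv.prodComm ℝ E' E) (x := (y, x)) ⟨hx, hy⟩
    (v, 0) (w, 0)).symm.trans (W.swap.ricciLocal_base_base hy hx v w)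

end WarpedOn

end Warped

/-! ### From manifolds to charts -/

section Chart

variable {E : Type*} [NormedAddCommGroup E] [NormedSpace ℝ E]
  {H : Type*} [TopologicalSpace H] {I : ModelWithCorners ℝ E H}
  {M : Type*} [TopologicalSpace M] [ChartedSpace H M] [IsManifold I ∞ M]

/-- The tangent space at `x` is by definition the model space read in the chart at `x`. -/
theorem vecInChart_eq (x : M) (v : TangentSpace I x) : vecInChart I x v = v := by
  have : IsManifold I 1 M := IsManifold.of_le (n := ∞) (by simp)
  rw [vecInChart, mfderiv_extChartAt_self]
  rfl

variable [I.Boundaryless]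

theorem dirDeriv_eq_fderiv {u : M → ℝ} {x : M} (hu : MDifferentiableAt I 𝓘(ℝ, ℝ) u x)
    (v : TangentSpace I x) :
    dirDeriv I u x v
      = fderiv ℝ (u ∘ (extChartAt I x).symm) (extChartAt I x x) (vecInChart I x v) := by
  rw [vecInChart_eq, dirDeriv, hu.mfderiv]
  simp only [writtenInExtChartAt, I.range_eq_univ, fderivWithin_univ]
  rfl

namespace PseudoRiemannianMetric

variable (g : PseudoRiemannianMetric I M)

theorem metricOn_formInChart (x₀ : M) :
    MetricOn (formInChart I g.val x₀) (extChartAt I x₀).target where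
  isOpen := isOpen_extChartAt_target x₀
  smooth := g.smooth x₀
  symm y _ v w := g.symm _ _ _
  nondegenerate y hy v hv := by
    have : IsManifold I 1 M := IsManifold.of_le (n := ∞) (by simp)
    have hinv := isInvertible_mfderivWithin_extChartAt_symm (I := I) (x := x₀) hy
    rw [I.range_eq_univ, mfderivWithin_univ] at hinv
    refine hinv.injective ((g.nondegenerate _ _ fun w => ?_).trans (map_zero _).symm)
    -- The derivative of a chart is onto, so testing against its range is enough.
    obtain ⟨w', rfl⟩ := hinv.surjective w
    exact hv w'

theorem val_eq_formInChart (x : M) (v w : TangentSpace I x) :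
    g.val x v w = formInChart I g.val x (extChartAt I x x) (vecInChart I x v)
      (vecInChart I x w) := by
  have : IsManifold I 1 M := IsManifold.of_le (n := ∞) (by simp)
  have h1 := mfderivWithin_range_extChartAt_symm (I := I) (x := x)
  rw [I.range_eq_univ, mfderivWithin_univ] at h1
  rw [vecInChart_eq, vecInChart_eq]
  have h2 : (extChartAt I x).symm (extChartAt I x x) = x := extChartAt_to_inv x
  have key : ∀ (x' : M) (v' w' : E), x' = x → v' = v → w' = w →
      g.val x v w = g.val x' v' w' := by
    rintro _ _ _ rfl rfl rfl
    rfl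
  exact key _ _ _ h2 (congrArg (fun A : E →L[ℝ] E => A v) h1)
    (congrArg (fun A : E →L[ℝ] E => A w) h1)

variable [FiniteDimensional ℝ E]

/-- The squared norm of a gradient, computed in the chart at the point. -/
theorem gradNormSq_eq {u : M → ℝ} {x : M} (hu : MDifferentiableAt I 𝓘(ℝ, ℝ) u x) :
    g.gradNormSq u x
      = fderiv ℝ (u ∘ (extChartAt I x).symm) (extChartAt I x x)
          (gradLocal (formInChart I g.val x) (u ∘ (extChartAt I x).symm) (extChartAt I x x)) := by
  let b : E →L[ℝ] E →L[ℝ] ℝ := g.val x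
  have hinv : b.IsInvertible := isInvertible_of_nondegenerate (g.nondegenerate x)
  have hgrad : ∀ v, g.val x (g.grad u x) v = dirDeriv I u x v := fun v =>
    congrArg (fun l : E →L[ℝ] ℝ => l v) (hinv.self_apply_inverse (mfderiv I 𝓘(ℝ, ℝ) u x))
  have hmem := mem_extChartAt_target (I := I) x
  have hvec : vecInChart I x (g.grad u x)
      = gradLocal (formInChart I g.val x) (u ∘ (extChartAt I x).symm) (extChartAt I x x) := by
    refine (g.metricOn_formInChart x).ext hmem fun z => ?_
    rw [(g.metricOn_formInChart x).apply_gradLocal hmem]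
    have h1 := (g.val_eq_formInChart x (g.grad u x) z).symm.trans
      ((hgrad z).trans (dirDeriv_eq_fderiv hu z))
    rwa [vecInChart_eq x z] at h1
  rw [gradNormSq, hgrad, dirDeriv_eq_fderiv hu, hvec]

theorem laplacian_scale {c : ℝ} (hc : c ≠ 0) {u : M → ℝ} (hu : ContMDiff I 𝓘(ℝ, ℝ) ∞ u) (x : M) :
    (g.scale c hc).laplacian u x
      = c⁻¹ * laplacianLocal (formInChart I g.val x) (u ∘ (extChartAt I x).symm)
          (extChartAt I x x) :=
  laplacianLocal_smul hc (g.metricOn_formInChart x)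
    (contMDiffOn_iff_contDiffOn.1 (hu.comp_contMDiffOn (contMDiffOn_extChartAt_symm x)))
    (mem_extChartAt_target x)

end PseudoRiemannianMetric

end Chart

/-! ### Doubly warped products in the product chart -/

section Product

variable {E : Type*} [NormedAddCommGroup E] [NormedSpace ℝ E]
  {H : Type*} [TopologicalSpace H] {I : ModelWithCorners ℝ E H}
  {B : Type*} [TopologicalSpace B] [ChartedSpace H B] [IsManifold I ∞ B]
  {E' : Type*} [NormedAddCommGroup E'] [NormedSpace ℝ E']
  {H' : Type*} [TopologicalSpace H'] {J : ModelWithCorners ℝ E' H'}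
  {F : Type*} [TopologicalSpace F] [ChartedSpace H' F] [IsManifold J ∞ F]

theorem vecInChart_liftB (p : B) (q : F) (x : TangentSpace I p) :
    vecInChart (I.prod J) (p, q) (liftB I J p q x) = (vecInChart I p x, (0 : E')) := by
  rw [vecInChart_eq, vecInChart_eq, liftB, mfderiv_prod_left]
  rfl

theorem vecInChart_liftF (p : B) (q : F) (v : TangentSpace J q) :
    vecInChart (I.prod J) (p, q) (liftF I J p q v) = ((0 : E), vecInChart J q v) := by
  rw [vecInChart_eq, vecInChart_eq, liftF, mfderiv_prod_right]
  rfl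

variable [FiniteDimensional ℝ E] [FiniteDimensional ℝ E'] [I.Boundaryless] [J.Boundaryless]

/-- In the product chart, the doubly warped product is a doubly warped metric on an open set of a
vector space. -/
theorem warpedOn_formInChart (gB : PseudoRiemannianMetric I B) (gF : PseudoRiemannianMetric J F)
    (h : F → ℝ) (hh : ContMDiff J 𝓘(ℝ, ℝ) ∞ h) (hpos : ∀ q, 0 < h q)
    (f : B → ℝ) (hf : ContMDiff I 𝓘(ℝ, ℝ) ∞ f) (fpos : ∀ p, 0 < f p) (p : B) (q : F) :
    WarpedOn (formInChart I gB.val p) (formInChart J gF.val q)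
      (formInChart (I.prod J) (doublyWarped gB gF h hh hpos f hf fpos).val (p, q))
      (f ∘ (extChartAt I p).symm) (h ∘ (extChartAt J q).symm)
      (extChartAt I p).target (extChartAt J q).target where
  base := gB.metricOn_formInChart p
  fiber := gF.metricOn_formInChart q
  total := by
    have h1 := (doublyWarped gB gF h hh hpos f hf fpos).metricOn_formInChart (p, q)
    rwa [extChartAt_prod] at h1
  smooth_f := contMDiffOn_iff_contDiffOn.1 (hf.comp_contMDiffOn (contMDiffOn_extChartAt_symm p))
  smooth_h := contMDiffOn_iff_contDiffOn.1 (hh.comp_contMDiffOn (contMDiffOn_extChartAt_symm q))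
  f_ne x _ := (fpos _).ne'
  h_ne y _ := (hpos _).ne'
  apply x hx y hy v w := by
    refine formInChart_warpedForm gB gF h f (p, q) (x, y) ?_ v w
    rw [extChartAt_prod]
    exact ⟨hx, hy⟩

end Product

end DoublyWarped

end

open DoublyWarped in
theorem corollary4p1
    {E : Type*} [NormedAddCommGroup E] [NormedSpace ℝ E] [FiniteDimensional ℝ E]
    {H : Type*} [TopologicalSpace H] (I : ModelWithCorners ℝ E H) [I.Boundaryless]
    {B : Type*} [TopologicalSpace B] [ChartedSpace H B] [IsManifold I ∞ B]
    {E' : Type*} [NormedAddCommGroup E'] [NormedSpace ℝ E'] [FiniteDimensional ℝ E']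
    {H' : Type*} [TopologicalSpace H'] (J : ModelWithCorners ℝ E' H') [J.Boundaryless]
    {F : Type*} [TopologicalSpace F] [ChartedSpace H' F] [IsManifold J ∞ F]
    (m n : ℕ) (hm : Module.finrank ℝ E = m) (hn : Module.finrank ℝ E' = n)
    (hm1 : 1 < m) (hn1 : 1 < n)
    (gB : PseudoRiemannianMetric I B) (gF : PseudoRiemannianMetric J F)
    (h : F → ℝ) (hh : ContMDiff J 𝓘(ℝ, ℝ) ∞ h) (hpos : ∀ q, 0 < h q)
    (f : B → ℝ) (hf : ContMDiff I 𝓘(ℝ, ℝ) ∞ f) (fpos : ∀ p, 0 < f p)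
    (gM : PseudoRiemannianMetric (I.prod J) (B × F))
    (hgM : gM = doublyWarped gB gF h hh hpos f hf fpos)
    (p : B) (q : F) :
    (∀ x y : TangentSpace I p,
      gM.ricci (p, q) (liftB I J p q x) (liftB I J p q y)
        = gB.ricci p x y
          - gM.val (p, q) (liftB I J p q x) (liftB I J p q y) *
            ((gF.scale (f p ^ 2) (pow_pos (fpos p) 2).ne').laplacian h q / h q
              + ((m : ℝ) - 1) * (gM.gradNormSq (h ∘ Prod.snd) (p, q) / h q ^ 2))
          - (n : ℝ) / f p * gB.hessian f p x y) ∧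
    (∀ (x : TangentSpace I p) (v : TangentSpace J q),
      gM.ricci (p, q) (liftB I J p q x) (liftF I J p q v)
        = ((m : ℝ) + (n : ℝ) - 2) * (dirDeriv I f p x / f p) * (dirDeriv J h q v / h q)) ∧
    (∀ v w : TangentSpace J q,
      gM.ricci (p, q) (liftF I J p q v) (liftF I J p q w)
        = gF.ricci q v w
          - gM.val (p, q) (liftF I J p q v) (liftF I J p q w) *
            ((gB.scale (h q ^ 2) (pow_pos (hpos q) 2).ne').laplacian f p / f p
              + ((n : ℝ) - 1) * (gM.gradNormSq (f ∘ Prod.fst) (p, q) / f p ^ 2))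
          - (m : ℝ) / h q * gF.hessian h q v w) := by
  have W := warpedOn_formInChart gB gF h hh hpos f hf fpos p q
  rw [← hgM] at W
  have hx := mem_extChartAt_target (I := I) p
  have hy := mem_extChartAt_target (I := J) q
  have hfp : (f ∘ (extChartAt I p).symm) (extChartAt I p p) = f p :=
    congrArg f (extChartAt_to_inv p)
  have hhq : (h ∘ (extChartAt J q).symm) (extChartAt J q q) = h q :=
    congrArg h (extChartAt_to_inv q)
  have hfd : MDifferentiableAt I 𝓘(ℝ, ℝ) f p := hf.mdifferentiableAt (by simp)
  have hhd : MDifferentiableAt J 𝓘(ℝ, ℝ) h q := hh.mdifferentiableAt (by simp)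
  have hpt : extChartAt (I.prod J) (p, q) (p, q) = (extChartAt I p p, extChartAt J q q) := by
    rw [extChartAt_prod]
    rfl
  have hgradh : gM.gradNormSq (h ∘ Prod.snd) (p, q) = (f p ^ 2)⁻¹ *
      fderiv ℝ (h ∘ (extChartAt J q).symm) (extChartAt J q q)
        (gradLocal (formInChart J gF.val q) (h ∘ (extChartAt J q).symm) (extChartAt J q q)) := by
    have h1 := W.fderiv_gradLocal_comp_snd hx hy
    rw [hfp] at h1
    rw [gM.gradNormSq_eq ((hh.comp contMDiff_snd).mdifferentiableAt (by simp)), ← h1, hpt,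
      extChartAt_prod]
    rfl
  have hgradf : gM.gradNormSq (f ∘ Prod.fst) (p, q) = (h q ^ 2)⁻¹ *
      fderiv ℝ (f ∘ (extChartAt I p).symm) (extChartAt I p p)
        (gradLocal (formInChart I gB.val p) (f ∘ (extChartAt I p).symm) (extChartAt I p p)) := by
    have h1 := W.fderiv_gradLocal_comp_fst hx hy
    rw [hhq] at h1
    rw [gM.gradNormSq_eq ((hf.comp contMDiff_fst).mdifferentiableAt (by simp)), ← h1, hpt,
      extChartAt_prod]
    rfl
  refine ⟨fun x y => ?_, fun x v => ?_, fun v w => ?_⟩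
  · have key := W.ricciLocal_base_base hx hy (vecInChart I p x) (vecInChart I p y)
    rw [hfp, hhq, hm, hn] at key
    rw [gM.val_eq_formInChart, PseudoRiemannianMetric.ricci, hpt, vecInChart_liftB,
      vecInChart_liftB, key, W.apply _ hx _ hy, gF.laplacian_scale _ hh, hgradh, hhq]
    simp only [map_zero, mul_zero, add_zero]
    rfl
  · have key := W.ricciLocal_base_fiber hx hy (vecInChart I p x) (vecInChart J q v)
    rw [hfp, hhq, hm, hn] at key
    rw [PseudoRiemannianMetric.ricci, hpt, vecInChart_liftB, vecInChart_liftF, key,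
      dirDeriv_eq_fderiv hfd, dirDeriv_eq_fderiv hhd]
  · have key := W.ricciLocal_fiber_fiber hx hy (vecInChart J q v) (vecInChart J q w)
    rw [hfp, hhq, hm, hn] at key
    rw [gM.val_eq_formInChart, PseudoRiemannianMetric.ricci, hpt, vecInChart_liftF,
      vecInChart_liftF, key, W.apply _ hx _ hy, gB.laplacian_scale _ hf, hgradf, hfp]
    simp only [map_zero, mul_zero, zero_add]
    rfl
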